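/- Let $\alpha,\beta>-1$ be real and let $w(x)=(1-x)^{\alpha}(1+x)^{\beta}$ on $[-1,1]$. There is exactly one sequence $(P_n)_{n\ge 0}$ of real polynomials such that each $P_n$ is monic of degree $n$ and $\int_{-1}^{1}P_m(x)P_n(x)w(x)\,dx=0$ for all $m\ne n$ (the monic Jacobi polynomials). For all $m,n\ge 0$ the function $P_mP_nw$ is integrable on $[-1,1]$, and $$\int_{-1}^{1}P_m(x)P_n(x)(1-x)^{\alpha}(1+x)^{\beta}\,dx=h_n\,\delta_{m,n},\qquad h_n=\frac{2^{\alpha+\beta+2n+1}\,\Gamma(\alpha+n+1)\,\Gamma(\beta+n+1)\,n!}{(\alpha+\beta+n+1)_n\,\Gamma(\alpha+\beta+2n+2)},$$ where $(\lambda)_n=\lambda(\lambda+1)\cdots(\lambda+n-1)$, $(\lambda)_0=1$. In particular the squared norm of $P_n$ in $L^2([-1,1],w\,dx)$ is $h_n$. -/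

import Mathlib

open scoped Nat Polynomial

/-- The Jacobi weight `(1 - x)^α (1 + x)^β` on `[-1, 1]`. -/
noncomputable def jacobiWeight (α β x : ℝ) : ℝ :=
  (1 - x) ^ α * (1 + x) ^ β

/-- `P 0, P 1, P 2, …` is the sequence of monic orthogonal polynomials for the Jacobi weight with
parameters `α`, `β`: `P n` is monic of degree `n`, and distinct members are orthogonal on
`[-1, 1]` with respect to the weight. -/
structure IsMonicJacobi (α β : ℝ) (P : ℕ → ℝ[X]) : Prop where
  monic : ∀ n, (P n).Monic
  natDegree_eq : ∀ n, (P n).natDegree = n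
  orthogonal : ∀ m n, m ≠ n →
    ∫ x in (-1 : ℝ)..1, (P m).eval x * (P n).eval x * jacobiWeight α β x = 0

/-! Induction on the degree, with the parameters varying. Integration by parts makes `jacobiRaise`
adjoint to differentiation, from weight `(α + 1, β + 1)` to weight `(α, β)`. It raises the degree by
one, so, made monic, it sends the degree `n` polynomial for `(α + 1, β + 1)` to the degree `n + 1`
polynomial for `(α, β)`. The same adjunction gives the norm recursion, which the closed form
satisfies (`jacobiNormSq_succ`); the base case is a Beta integral. Uniqueness follows from existence
in every degree and positivity of the norms. -/

/-- The linear functional `p ↦ ∫ p w` attached to the Jacobi weight. -/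
noncomputable def jacobiIntegral (α β : ℝ) (p : ℝ[X]) : ℝ :=
  ∫ x in (-1 : ℝ)..1, p.eval x * jacobiWeight α β x

/-- The closed form of the squared norm of the monic Jacobi polynomial of degree `n`. -/
noncomputable def jacobiNormSq (α β : ℝ) (n : ℕ) : ℝ :=
  (2 : ℝ) ^ (α + β + 2 * (n : ℝ) + 1) *
      Real.Gamma (α + n + 1) * Real.Gamma (β + n + 1) * (n ! : ℝ) /
    ((ascPochhammer ℝ n).eval (α + β + n + 1) *
      Real.Gamma (α + β + 2 * (n : ℝ) + 2))

/-- `p` is monic of degree `n` and orthogonal, for the Jacobi weight, to all polynomials of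
smaller degree. -/
structure IsMonicJacobiPoly (α β : ℝ) (n : ℕ) (p : ℝ[X]) : Prop where
  monic : p.Monic
  natDegree_eq : p.natDegree = n
  orthogonal : ∀ q : ℝ[X], q.degree < n → jacobiIntegral α β (p * q) = 0

/-! ### Integrability and linearity -/

theorem jacobiWeight_intervalIntegrable {α β : ℝ} (hα : -1 < α) (hβ : -1 < β) :
    IntervalIntegrable (jacobiWeight α β) MeasureTheory.volume (-1) 1 := by
  -- Split at `0`: on each half only one factor can be singular, and the other is continuous.
  have hl : IntervalIntegrable (jacobiWeight α β) MeasureTheory.volume (-1) 0 := by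
    have h : IntervalIntegrable (fun x : ℝ => (1 + x) ^ β) MeasureTheory.volume (-1) 0 := by
      simpa using (intervalIntegral.intervalIntegrable_rpow' (a := 0) (b := 1) hβ).comp_add_left 1
    refine h.continuousOn_mul (g := fun x : ℝ => (1 - x) ^ α) ?_
    refine ContinuousOn.rpow_const (by fun_prop) fun x hx => Or.inl ?_
    rw [Set.uIcc_of_le (by norm_num)] at hx
    linarith [hx.2]
  have hr : IntervalIntegrable (jacobiWeight α β) MeasureTheory.volume 0 1 := by
    have h : IntervalIntegrable (fun x : ℝ => (1 - x) ^ α) MeasureTheory.volume 0 1 := by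
      simpa using
        ((intervalIntegral.intervalIntegrable_rpow' (a := 0) (b := 1) hα).comp_sub_left 1).symm
    refine h.mul_continuousOn (g := fun x : ℝ => (1 + x) ^ β) ?_
    refine ContinuousOn.rpow_const (by fun_prop) fun x hx => Or.inl ?_
    rw [Set.uIcc_of_le (by norm_num)] at hx
    linarith [hx.1]
  exact hl.trans hr

theorem eval_mul_jacobiWeight_intervalIntegrable {α β : ℝ} (hα : -1 < α) (hβ : -1 < β)
    (p : ℝ[X]) :
    IntervalIntegrable (fun x => p.eval x * jacobiWeight α β x) MeasureTheory.volume (-1) 1 :=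
  (jacobiWeight_intervalIntegrable hα hβ).continuousOn_mul p.continuous.continuousOn

theorem jacobiIntegral_add {α β : ℝ} (hα : -1 < α) (hβ : -1 < β) (p q : ℝ[X]) :
    jacobiIntegral α β (p + q) = jacobiIntegral α β p + jacobiIntegral α β q := by
  simp only [jacobiIntegral]
  rw [← intervalIntegral.integral_add (eval_mul_jacobiWeight_intervalIntegrable hα hβ p)
    (eval_mul_jacobiWeight_intervalIntegrable hα hβ q)]
  simp only [Polynomial.eval_add, add_mul]

theorem jacobiIntegral_C_mul (α β c : ℝ) (p : ℝ[X]) :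
    jacobiIntegral α β (Polynomial.C c * p) = c * jacobiIntegral α β p := by
  simp only [jacobiIntegral, ← intervalIntegral.integral_const_mul, Polynomial.eval_mul,
    Polynomial.eval_C, mul_assoc]

theorem jacobiIntegral_sub {α β : ℝ} (hα : -1 < α) (hβ : -1 < β) (p q : ℝ[X]) :
    jacobiIntegral α β (p - q) = jacobiIntegral α β p - jacobiIntegral α β q := by
  have h := jacobiIntegral_add hα hβ (p - q) q
  rw [sub_add_cancel] at h
  linarith

/-! ### Integration by parts and the raising operator -/

theorem jacobiWeight_add_one {α β x : ℝ} (hx : x ∈ Set.Ioo (-1 : ℝ) 1) :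
    jacobiWeight (α + 1) (β + 1) x = (1 - x ^ 2) * jacobiWeight α β x := by
  have h1 : (0 : ℝ) < 1 - x := by linarith [hx.2]
  have h2 : (0 : ℝ) < 1 + x := by linarith [hx.1]
  rw [jacobiWeight, jacobiWeight, Real.rpow_add_one h1.ne', Real.rpow_add_one h2.ne']
  ring

theorem jacobiIntegral_add_one (α β : ℝ) (p : ℝ[X]) :
    jacobiIntegral (α + 1) (β + 1) p = jacobiIntegral α β ((1 - Polynomial.X ^ 2) * p) := by
  simp only [jacobiIntegral]
  rw [intervalIntegral.integral_of_le (by norm_num), intervalIntegral.integral_of_le (by norm_num),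
    MeasureTheory.integral_Ioc_eq_integral_Ioo, MeasureTheory.integral_Ioc_eq_integral_Ioo]
  refine MeasureTheory.setIntegral_congr_fun measurableSet_Ioo fun x hx => ?_
  simp only [jacobiWeight_add_one hx, Polynomial.eval_mul, Polynomial.eval_sub,
    Polynomial.eval_one, Polynomial.eval_pow, Polynomial.eval_X]
  ring

/-- The integral of the derivative of `p(x) (1 - x)^(α + 1) (1 + x)^(β + 1)` vanishes. -/
theorem jacobiIntegral_pearson {α β : ℝ} (hα : -1 < α) (hβ : -1 < β) (p : ℝ[X]) :
    jacobiIntegral α β ((1 - Polynomial.X ^ 2) * Polynomial.derivative p +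
      (Polynomial.C (β - α) - Polynomial.C (α + β + 2) * Polynomial.X) * p) = 0 := by
  have h := intervalIntegral.integral_eq_sub_of_hasDerivAt_of_le (a := -1) (b := 1)
    (f := fun x => p.eval x * jacobiWeight (α + 1) (β + 1) x)
    (f' := fun x => ((1 - Polynomial.X ^ 2) * Polynomial.derivative p +
      (Polynomial.C (β - α) - Polynomial.C (α + β + 2) * Polynomial.X) * p).eval x *
        jacobiWeight α β x) (by norm_num) ?_ ?_
    (eval_mul_jacobiWeight_intervalIntegrable hα hβ _)
  · rw [jacobiIntegral, h]
    -- Both boundary terms vanish, the exponents `α + 1` and `β + 1` being nonzero.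
    simp [jacobiWeight, Real.zero_rpow (show α + 1 ≠ 0 by linarith),
      Real.zero_rpow (show β + 1 ≠ 0 by linarith)]
  · refine p.continuous.continuousOn.mul (ContinuousOn.mul ?_ ?_)
    · exact ContinuousOn.rpow_const (by fun_prop) fun x _ => Or.inr (by linarith)
    · exact ContinuousOn.rpow_const (by fun_prop) fun x _ => Or.inr (by linarith)
  · intro x hx
    have h1 : (0 : ℝ) < 1 - x := by linarith [hx.2]
    have h2 : (0 : ℝ) < 1 + x := by linarith [hx.1]
    have d1 := ((hasDerivAt_id x).const_sub 1).rpow_const (p := α + 1) (Or.inl h1.ne')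
    have d2 := ((hasDerivAt_id x).const_add 1).rpow_const (p := β + 1) (Or.inl h2.ne')
    refine ((p.hasDerivAt x).mul (d1.mul d2)).congr_deriv ?_
    simp only [jacobiWeight, id, Pi.mul_apply, add_sub_cancel_right, Real.rpow_add_one h1.ne',
      Real.rpow_add_one h2.ne', Polynomial.eval_add, Polynomial.eval_sub, Polynomial.eval_mul,
      Polynomial.eval_one, Polynomial.eval_pow, Polynomial.eval_X, Polynomial.eval_C]
    ring

/-- The raising operator: the adjoint of the derivative with respect to the Jacobi weights. -/
noncomputable def jacobiRaise (α β : ℝ) (q : ℝ[X]) : ℝ[X] :=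
  Polynomial.C (α + β + 2) * Polynomial.X * q - Polynomial.C (β - α) * q -
    (1 - Polynomial.X ^ 2) * Polynomial.derivative q

theorem jacobiIntegral_jacobiRaise_mul {α β : ℝ} (hα : -1 < α) (hβ : -1 < β) (p q : ℝ[X]) :
    jacobiIntegral α β (jacobiRaise α β q * p) =
      jacobiIntegral (α + 1) (β + 1) (q * Polynomial.derivative p) := by
  have h := jacobiIntegral_pearson hα hβ (p * q)
  rw [jacobiIntegral_add_one, ← sub_eq_zero, ← jacobiIntegral_sub hα hβ]
  rw [show jacobiRaise α β q * p - (1 - Polynomial.X ^ 2) * (q * Polynomial.derivative p) =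
    Polynomial.C (-1) * ((1 - Polynomial.X ^ 2) * Polynomial.derivative (p * q) +
      (Polynomial.C (β - α) - Polynomial.C (α + β + 2) * Polynomial.X) * (p * q)) by
    rw [jacobiRaise, Polynomial.derivative_mul, Polynomial.C_neg, Polynomial.C_1]; ring]
  rw [jacobiIntegral_C_mul, h, mul_zero]

theorem natDegree_jacobiRaise_le (α β : ℝ) (q : ℝ[X]) :
    (jacobiRaise α β q).natDegree ≤ q.natDegree + 1 := by
  rw [Polynomial.natDegree_le_iff_coeff_eq_zero]
  intro N hN
  obtain ⟨k, rfl⟩ : ∃ k, N = k + 2 := ⟨N - 2, by omega⟩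
  have h (j : ℕ) (hj : q.natDegree < j) : q.coeff j = 0 :=
    Polynomial.coeff_eq_zero_of_natDegree_lt hj
  simp [-map_add, jacobiRaise, sub_mul, mul_assoc, Polynomial.coeff_X_pow_mul, Polynomial.coeff_derivative,
    Polynomial.coeff_X_mul, h (k + 1) (by omega), h (k + 2) (by omega), h (k + 2 + 1) (by omega)]

/-- The terms `(α + β + 2) X q` and `X ^ 2 q'` contribute `α + β + 2` and `n`. -/
theorem coeff_jacobiRaise (α β : ℝ) {n : ℕ} {q : ℝ[X]} (hq : q.natDegree = n) :
    (jacobiRaise α β q).coeff (n + 1) = (α + β + n + 2) * q.coeff n := by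
  have h (j : ℕ) (hj : n < j) : q.coeff j = 0 :=
    Polynomial.coeff_eq_zero_of_natDegree_lt (hq.trans_lt hj)
  rcases n with _ | n
  · rw [Polynomial.natDegree_eq_zero] at hq
    obtain ⟨c, rfl⟩ := hq
    simp [-map_add, jacobiRaise, mul_assoc]
  · simp [-map_add, jacobiRaise, sub_mul, mul_assoc, Polynomial.coeff_X_pow_mul,
      Polynomial.coeff_derivative, Polynomial.coeff_X_mul, h (n + 1 + 1) (by omega),
      h (n + 1 + 1 + 1) (by omega)]
    ring

/-! ### The closed form -/

/-- The powers and Gamma factors agree on both sides; only one factor of the factorial and the first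
factor of the Pochhammer symbol split off. -/
theorem jacobiNormSq_succ {α β : ℝ} (n : ℕ) :
    jacobiNormSq α β (n + 1) =
      (n + 1) / (α + β + n + 2) * jacobiNormSq (α + 1) (β + 1) n := by
  rw [jacobiNormSq, jacobiNormSq, ascPochhammer_succ_left, Nat.factorial_succ]
  simp only [Polynomial.eval_mul, Polynomial.eval_comp, Polynomial.eval_add, Polynomial.eval_X,
    Polynomial.eval_one, Nat.cast_add, Nat.cast_mul, Nat.cast_one]
  rw [div_mul_div_comm]
  congr 1
  · ring_nf
  · ring_nf

theorem jacobiNormSq_pos {α β : ℝ} (hα : -1 < α) (hβ : -1 < β) (n : ℕ) :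
    0 < jacobiNormSq α β n := by
  induction n generalizing α β with
  | zero =>
    have h1 := Real.Gamma_pos_of_pos (show 0 < α + 1 by linarith)
    have h2 := Real.Gamma_pos_of_pos (show 0 < β + 1 by linarith)
    have h3 := Real.Gamma_pos_of_pos (show 0 < α + β + 2 by linarith)
    simp only [jacobiNormSq, CharP.cast_eq_zero, mul_zero, add_zero, Nat.factorial_zero,
      Nat.cast_one, mul_one, ascPochhammer_zero, Polynomial.eval_one, one_mul]
    positivity
  | succ n ih =>
    rw [jacobiNormSq_succ]
    have hn : (0 : ℝ) ≤ n := n.cast_nonneg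
    exact mul_pos (div_pos (by linarith) (by linarith)) (ih (by linarith) (by linarith))

theorem jacobiIntegral_one {α β : ℝ} (hα : -1 < α) (hβ : -1 < β) :
    jacobiIntegral α β 1 = jacobiNormSq α β 0 := by
  -- The shift `x ↦ 1 + x` leads to a Beta integral scaled to `[0, 2]`, evaluated over `ℂ`.
  have hs : ∫ x in (-1 : ℝ)..1, jacobiWeight α β x =
      ∫ x in (0 : ℝ)..2, x ^ β * (2 - x) ^ α := by
    have h := intervalIntegral.integral_comp_add_left (a := -1) (b := 1)
      (fun x : ℝ => x ^ β * (2 - x) ^ α) 1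
    norm_num at h
    rw [← h]
    refine intervalIntegral.integral_congr fun x _ => ?_
    simp only [jacobiWeight]
    rw [show (2 : ℝ) - (1 + x) = 1 - x by ring, mul_comm]
  have hc := Complex.betaIntegral_scaled ((β + 1 : ℝ) : ℂ) ((α + 1 : ℝ) : ℂ) (a := 2) two_pos
  rw [Complex.betaIntegral_eq_Gamma_mul_div _ _ (by simpa using (by linarith : 0 < β + 1))
    (by simpa using (by linarith : 0 < α + 1))] at hc
  have hl : (∫ x in (0 : ℝ)..2, (x : ℂ) ^ (((β + 1 : ℝ) : ℂ) - 1) *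
      (((2 : ℝ) : ℂ) - x) ^ (((α + 1 : ℝ) : ℂ) - 1)) =
      ((∫ x in (0 : ℝ)..2, x ^ β * (2 - x) ^ α : ℝ) : ℂ) := by
    rw [← intervalIntegral.integral_ofReal]
    refine intervalIntegral.integral_congr fun x hx => ?_
    rw [Set.uIcc_of_le (by norm_num)] at hx
    simp only [Complex.ofReal_mul]
    rw [Complex.ofReal_cpow hx.1, Complex.ofReal_cpow (by linarith [hx.2])]
    push_cast
    simp
  rw [hl, ← Complex.ofReal_add, Complex.Gamma_ofReal, Complex.Gamma_ofReal, Complex.Gamma_ofReal,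
    ← Complex.ofReal_one, ← Complex.ofReal_sub, ← Complex.ofReal_cpow (by norm_num)] at hc
  norm_cast at hc
  simp only [jacobiIntegral, Polynomial.eval_one, one_mul]
  rw [hs, hc, jacobiNormSq]
  simp only [CharP.cast_eq_zero, mul_zero, add_zero, Nat.factorial_zero,
    Nat.cast_one, mul_one, ascPochhammer_zero, Polynomial.eval_one, one_mul]
  rw [show β + 1 + (α + 1) - 1 = α + β + 1 by ring, show β + 1 + (α + 1) = α + β + 2 by ring]
  ring

/-! ### Existence, uniqueness and norms -/

theorem Polynomial.Monic.degree_sub_C_leadingCoeff_mul_lt {p q : ℝ[X]} (hp : p.Monic)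
    (hd : p.natDegree = q.natDegree) (hq : q ≠ 0) :
    (q - Polynomial.C q.leadingCoeff * p).degree < q.degree := by
  have hc : q.leadingCoeff ≠ 0 := Polynomial.leadingCoeff_ne_zero.mpr hq
  refine Polynomial.degree_sub_lt_left ?_ hq ?_
  · rw [Polynomial.degree_C_mul hc, Polynomial.degree_eq_natDegree hq,
      Polynomial.degree_eq_natDegree hp.ne_zero, hd]
  · simp [hp.leadingCoeff]

/-- Subtracting `q.leadingCoeff` times `p` from `q` lowers its degree, and `p` is orthogonal to the
remainder. -/
theorem IsMonicJacobiPoly.jacobiIntegral_mul_eq {α β : ℝ} (hα : -1 < α) (hβ : -1 < β) {n : ℕ}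
    {p q : ℝ[X]} (hp : IsMonicJacobiPoly α β n p) (hq : q.natDegree = n) :
    jacobiIntegral α β (p * q) = q.leadingCoeff * jacobiIntegral α β (p * p) := by
  rcases eq_or_ne q 0 with rfl | hq0
  · simp [jacobiIntegral]
  have h := hp.monic.degree_sub_C_leadingCoeff_mul_lt (hp.natDegree_eq.trans hq.symm) hq0
  have h0 := hp.orthogonal _ (h.trans_eq (by rw [Polynomial.degree_eq_natDegree hq0, hq]))
  rw [mul_sub, jacobiIntegral_sub hα hβ, mul_left_comm, jacobiIntegral_C_mul] at h0
  linarith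

theorem exists_isMonicJacobiPoly {α β : ℝ} (hα : -1 < α) (hβ : -1 < β) (n : ℕ) :
    ∃ p, IsMonicJacobiPoly α β n p ∧ jacobiIntegral α β (p * p) = jacobiNormSq α β n := by
  induction n generalizing α β with
  | zero =>
    refine ⟨1, ⟨Polynomial.monic_one, Polynomial.natDegree_one, fun q hq => ?_⟩, ?_⟩
    · have : q = 0 := by simpa using hq
      simp [this, jacobiIntegral]
    · rw [mul_one, jacobiIntegral_one hα hβ]
  | succ n ih =>
    obtain ⟨q, hq, hnorm⟩ := ih (α := α + 1) (β := β + 1) (by linarith) (by linarith)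
    have hn : (0 : ℝ) ≤ n := n.cast_nonneg
    have hc : α + β + n + 2 ≠ 0 := by linarith
    set p := Polynomial.C (α + β + n + 2)⁻¹ * jacobiRaise α β q with hpdef
    have hint (r : ℝ[X]) : jacobiIntegral α β (p * r) =
        (α + β + n + 2)⁻¹ * jacobiIntegral (α + 1) (β + 1) (q * Polynomial.derivative r) := by
      rw [hpdef, mul_assoc, jacobiIntegral_C_mul, jacobiIntegral_jacobiRaise_mul hα hβ]
    have hle : p.natDegree ≤ n + 1 :=
      (Polynomial.natDegree_C_mul_le _ _).trans
        ((natDegree_jacobiRaise_le α β q).trans_eq (by rw [hq.natDegree_eq]))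
    have hlead : p.coeff (n + 1) = 1 := by
      have hq1 : q.coeff n = 1 := by
        have := hq.monic.coeff_natDegree
        rwa [hq.natDegree_eq] at this
      rw [hpdef, Polynomial.coeff_C_mul, coeff_jacobiRaise α β hq.natDegree_eq, hq1, mul_one,
        inv_mul_cancel₀ hc]
    have hmonic : p.Monic := Polynomial.monic_of_natDegree_le_of_coeff_eq_one _ hle hlead
    have hdeg : p.natDegree = n + 1 :=
      le_antisymm hle (Polynomial.le_natDegree_of_ne_zero (by rw [hlead]; exact one_ne_zero))
    refine ⟨p, ⟨hmonic, hdeg, fun r hr => ?_⟩, ?_⟩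
    · rw [hint, hq.orthogonal _ ?_, mul_zero]
      rcases eq_or_ne r 0 with rfl | hr0
      · simp
      · have h1 := Polynomial.degree_derivative_lt hr0
        have h2 : r.degree ≤ n := 
          Polynomial.degree_le_of_natDegree_le
            (Nat.le_of_lt_succ ((Polynomial.natDegree_lt_iff_degree_lt hr0).mpr hr))
        exact h1.trans_le h2
    · have hd : (Polynomial.derivative p).natDegree = n := by
        rw [Polynomial.natDegree_derivative, hdeg, Nat.add_sub_cancel]
      have hlc : (Polynomial.derivative p).leadingCoeff = n + 1 := by
        rw [Polynomial.leadingCoeff, hd, Polynomial.coeff_derivative, hlead, one_mul]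
      -- Pairing `p` with itself becomes pairing `q` with `p'`, of degree `n` and leading
      -- coefficient `n + 1`.
      rw [hint, hq.jacobiIntegral_mul_eq (by linarith) (by linarith) hd, hlc, hnorm,
        jacobiNormSq_succ]
      ring

theorem IsMonicJacobiPoly.unique {α β : ℝ} (hα : -1 < α) (hβ : -1 < β) {n : ℕ} {p q : ℝ[X]}
    (hp : IsMonicJacobiPoly α β n p) (hq : IsMonicJacobiPoly α β n q) : p = q := by
  by_contra hne
  have hd0 : p - q ≠ 0 := sub_ne_zero.mpr hne
  have hlt : (p - q).degree < n := by
    refine (Polynomial.degree_sub_lt_left ?_ hp.monic.ne_zero ?_).trans_eq ?_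
    · rw [Polynomial.degree_eq_natDegree hp.monic.ne_zero,
        Polynomial.degree_eq_natDegree hq.monic.ne_zero, hp.natDegree_eq, hq.natDegree_eq]
    · rw [hp.monic.leadingCoeff, hq.monic.leadingCoeff]
    · rw [Polynomial.degree_eq_natDegree hp.monic.ne_zero, hp.natDegree_eq]
  -- Test `p - q` against the orthogonal polynomial of its own degree: the pairing is zero, yet
  -- equals a nonzero leading coefficient times a positive norm.
  obtain ⟨r, hr, hnorm⟩ := exists_isMonicJacobiPoly hα hβ (p - q).natDegree
  have h1 := hr.jacobiIntegral_mul_eq hα hβ rfl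
  have hrlt : r.degree < n := by
    rwa [Polynomial.degree_eq_natDegree hr.monic.ne_zero, hr.natDegree_eq,
      ← Polynomial.degree_eq_natDegree hd0]
  rw [mul_comm, sub_mul, jacobiIntegral_sub hα hβ, hp.orthogonal r hrlt, hq.orthogonal r hrlt,
    sub_zero, hnorm] at h1
  exact mul_ne_zero (Polynomial.leadingCoeff_ne_zero.mpr hd0) (jacobiNormSq_pos hα hβ _).ne' h1.symm

theorem IsMonicJacobiPoly.jacobiIntegral_mul_self {α β : ℝ} (hα : -1 < α) (hβ : -1 < β) {n : ℕ}
    {p : ℝ[X]} (hp : IsMonicJacobiPoly α β n p) :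
    jacobiIntegral α β (p * p) = jacobiNormSq α β n := by
  obtain ⟨q, hq, hnorm⟩ := exists_isMonicJacobiPoly hα hβ n
  rwa [hp.unique hα hβ hq]

/-- Strong induction on the degree of `q`, removing its leading term with `P q.natDegree`. -/
theorem IsMonicJacobi.isMonicJacobiPoly {α β : ℝ} (hα : -1 < α) (hβ : -1 < β) {P : ℕ → ℝ[X]}
    (hP : IsMonicJacobi α β P) (n : ℕ) : IsMonicJacobiPoly α β n (P n) := by
  refine ⟨hP.monic n, hP.natDegree_eq n, fun q => ?_⟩
  induction hk : q.degree using WellFoundedLT.induction generalizing q with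
  | ind k ih =>
    intro hq
    rcases eq_or_ne q 0 with rfl | hq0
    · simp [jacobiIntegral]
    have hlt := (hP.monic q.natDegree).degree_sub_C_leadingCoeff_mul_lt (hP.natDegree_eq _) hq0
    rw [hk] at hlt
    have h := ih _ hlt _ rfl (hlt.trans hq)
    have hne : n ≠ q.natDegree := by
      rw [← hk, Polynomial.degree_eq_natDegree hq0] at hq
      exact (Nat.cast_lt.mp hq).ne'
    have ho : jacobiIntegral α β (P n * P q.natDegree) = 0 := by
      simpa [jacobiIntegral] using hP.orthogonal n q.natDegree hne
    rwa [mul_sub, jacobiIntegral_sub hα hβ, mul_left_comm, jacobiIntegral_C_mul, ho, mul_zero,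
      sub_zero] at h

theorem isMonicJacobi_of_isMonicJacobiPoly {α β : ℝ} {P : ℕ → ℝ[X]}
    (hP : ∀ n, IsMonicJacobiPoly α β n (P n)) : IsMonicJacobi α β P := by
  have key {m n : ℕ} (h : m < n) : jacobiIntegral α β (P n * P m) = 0 := by
    refine (hP n).orthogonal _ ?_
    rw [Polynomial.degree_eq_natDegree (hP m).monic.ne_zero, (hP m).natDegree_eq]
    exact_mod_cast h
  refine ⟨fun n => (hP n).monic, fun n => (hP n).natDegree_eq, fun m n hmn => ?_⟩
  simp only [← Polynomial.eval_mul]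
  rcases hmn.lt_or_gt with h | h
  · rw [mul_comm]
    exact key h
  · exact key h

theorem mainTheorem4 (α β : ℝ) (hα : -1 < α) (hβ : -1 < β) :
    (∃! P : ℕ → ℝ[X], IsMonicJacobi α β P) ∧
    ∀ P : ℕ → ℝ[X], IsMonicJacobi α β P → ∀ m n : ℕ,
      IntervalIntegrable
        (fun x : ℝ => (P m).eval x * (P n).eval x * jacobiWeight α β x)
        MeasureTheory.volume (-1) 1 ∧
      ∫ x in (-1 : ℝ)..1, (P m).eval x * (P n).eval x * jacobiWeight α β x =
        if m = n then
          (2 : ℝ) ^ (α + β + 2 * (n : ℝ) + 1) *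
              Real.Gamma (α + n + 1) * Real.Gamma (β + n + 1) * (n ! : ℝ) /
            ((ascPochhammer ℝ n).eval (α + β + n + 1) *
              Real.Gamma (α + β + 2 * (n : ℝ) + 2))
        else 0 := by
  refine ⟨?_, fun P hP m n => ⟨?_, ?_⟩⟩
  · choose P hP _ using fun n => exists_isMonicJacobiPoly hα hβ n
    refine ⟨P, isMonicJacobi_of_isMonicJacobiPoly hP, fun Q hQ => funext fun n => ?_⟩
    exact (hQ.isMonicJacobiPoly hα hβ n).unique hα hβ (hP n)
  · simpa using eval_mul_jacobiWeight_intervalIntegrable hα hβ (P m * P n)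
  · split_ifs with h
    · subst h
      simpa [jacobiIntegral, jacobiNormSq] using
        (hP.isMonicJacobiPoly hα hβ m).jacobiIntegral_mul_self hα hβ
    · exact hP.orthogonal m n h
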